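/- **Theorem (Diaconis--Van Daele Inversion Theorem).** Let $\mathbb{G}$ be a finite quantum group with algebra of functions $A=F(\mathbb{G})$. That is, $A$ is a finite-dimensional complex Hopf algebra, with comultiplication $\Delta$ and counit $\varepsilon$, which is also a $\mathrm{C}^*$-algebra and satisfies $\Delta(a^*)=\Delta(a)^*$ for all $a\in A$, where $(a\otimes b)^*=a^*\otimes b^*$. - There is exactly one Haar measure on $\mathbb{G}$: exactly one positive linear functional $\int_{\mathbb{G}}:A\to\mathbb{C}$ with $\int_{\mathbb{G}}1=1$ and $(I\otimes\int_{\mathbb{G}})\Delta(a)=\left(\int_{\mathbb{G}}a\right)1=(\int_{\mathbb{G}}\otimes I)\Delta(a)$ for all $a\in A$. - The linear map $\mathcal{F}:F(\mathbb{G})\to\mathbb{C}\mathbb{G}:=F(\mathbb{G})^*$, $\mathcal{F}(a)(b)=\int_{\mathbb{G}}ba$, is bijective. Define $\int_{\widehat{\mathbb{G}}}:=\varepsilon\circ\mathcal{F}^{-1}$ on $\mathbb{C}\mathbb{G}$. A representation of $\mathbb{G}$ on a complex vector space $V$ is a linear map $\kappa:V\to V\otimes A$ with $(\kappa\otimes I)\kappa=(I\otimes\Delta)\kappa$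 and $(I\otimes\varepsilon)\kappa=I$. It is irreducible if $V\neq0$ and the only subspaces $U\subseteq V$ with $\kappa(U)\subseteq U\otimes A$ are $0$ and $V$. Two representations are equivalent if there is an invertible intertwiner between them. Let $(\kappa_\alpha)_{\alpha\in\operatorname{Irr}(\mathbb{G})}$, with $\kappa_\alpha$ acting on $V_\alpha$, be irreducible representations of $\mathbb{G}$, one from each equivalence class. Then $\operatorname{Irr}(\mathbb{G})$ is finite and every $V_\alpha$ is finite-dimensional; put $d_\alpha=\dim V_\alpha$. Let $\overline{V_\alpha}$ be the conjugate vector space of $V_\alpha$, and let $\overline{\kappa}_\alpha:\overline{V_\alpha}\to\overline{V_\alpha}\otimes A$ be the conjugate representation: if $\kappa_\alpha(e_j)=\sum_i e_i\otimes\rho_{ij}$ for a basis $(e_i)$ of $V_\alpha$, then $\overline{\kappa}_\alpha(\overline{e_j})=\sum_i\overline{e_i}\otimes\rho_{ij}^*$. For $a\in F(\mathbb{G})$ let $\widehat{a}(\alpha)=(I_{\overline{V_\alpha}}\otimes\mathcal{F}(a))\circ\overline{\kappa}_\alpha\in L(\overline{V_\alpha})$ be its Fourier transform at $\alpha$. Then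 for every $a\in F(\mathbb{G})$ $$\int_{\widehat{\mathbb{G}}}\mathcal{F}(a)=\varepsilon(a)=\sum_{\alpha\in\operatorname{Irr}(\mathbb{G})}d_\alpha\operatorname{Tr}\left(\widehat{a}(\alpha)\right).$$ -/

import Mathlib

open scoped TensorProduct ComplexOrder

noncomputable section

namespace QuantumGroup

/-- `A` is the algebra of functions `F(𝔾)` on a finite quantum group `𝔾`: a finite-dimensional
C*-Hopf algebra, i.e. a complex Hopf algebra which is also a C*-algebra (for the given norm and
involution) and whose comultiplication satisfies `Δ(a*) = Δ(a)*`, where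
`(a ⊗ b)* = a* ⊗ b*`. -/
class IsFiniteQuantumGroup (A : Type*) [NormedRing A] [StarRing A] [HopfAlgebra ℂ A] : Prop
    extends CStarRing A, CompleteSpace A, NormSMulClass ℂ A, StarModule ℂ A,
      Module.Finite ℂ A where
  comul_star : ∀ a : A,
    CoalgebraStruct.comul (R := ℂ) (star a) = star (CoalgebraStruct.comul (R := ℂ) a)

section Haar

variable (A : Type*) [NormedRing A] [StarRing A] [HopfAlgebra ℂ A]

/-- A normalised state on `F(𝔾)` that is both left- and right-invariant:
`(I ⊗ h) Δ(a) = h(a) 1 = (h ⊗ I) Δ(a)`. -/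
structure IsHaarState {A : Type*} [NormedRing A] [StarRing A] [HopfAlgebra ℂ A]
    (h : Module.Dual ℂ A) : Prop where
  map_one : h 1 = 1
  nonneg : ∀ a : A, 0 ≤ h (star a * a)
  left_invariant : ∀ a : A,
    TensorProduct.rid ℂ A (h.lTensor A (CoalgebraStruct.comul a)) = h a • (1 : A)
  right_invariant : ∀ a : A,
    TensorProduct.lid ℂ A (h.rTensor A (CoalgebraStruct.comul a)) = h a • (1 : A)

/-- The Haar measure `∫_𝔾`: the invariant state on `F(𝔾)`. -/
def haar : Module.Dual ℂ A :=
  Classical.epsilon fun h => IsHaarState h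

/-- The map `𝓕 : F(𝔾) → ℂ𝔾 = F(𝔾)*`, `𝓕(a) = (b ↦ ∫_𝔾 b a)`. -/
def dualMap : A →ₗ[ℂ] Module.Dual ℂ A :=
  (LinearMap.mul ℂ A).flip.compr₂ (haar A)

/-- The functional `∫_𝔾̂ = ε ∘ 𝓕⁻¹` on `ℂ𝔾 = F(𝔾̂)`. -/
def dualHaar (φ : Module.Dual ℂ A) : ℂ :=
  CoalgebraStruct.counit (R := ℂ) (Function.invFun (dualMap A) φ)

end Haar

section Conj

/-- The conjugate vector space `V̄` of a complex vector space `V`: the same additive group, with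
scalar multiplication `c • v̄ = (c̄ • v)‾`. -/
def Conj (V : Type*) : Type _ := V

variable (V : Type*) [AddCommGroup V] [Module ℂ V]

instance : AddCommGroup (Conj V) := inferInstanceAs (AddCommGroup V)

instance : Module ℂ (Conj V) :=
  letI : Module ℂ (Conj V) := inferInstanceAs (Module ℂ V)
  Module.compHom (Conj V) (starRingEnd ℂ)

/-- The canonical conjugate-linear isomorphism `v ↦ v̄`. -/
def toConj : V ≃ₛₗ[starRingEnd ℂ] Conj V where
  toFun v := v
  invFun v := v
  left_inv _ := rfl
  right_inv _ := rfl
  map_add' _ _ := rfl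
  map_smul' c v := by
    change c • v = (starRingEnd ℂ (starRingEnd ℂ c)) • v
    rw [Complex.conj_conj]

end Conj

/-- A representation of `𝔾` on the complex vector space `V`, i.e. a corepresentation of
`A = F(𝔾)`: a linear map `κ : V → V ⊗ A` with `(κ ⊗ I) κ = (I ⊗ Δ) κ` and `(I ⊗ ε) κ = I`. -/
structure Corep (A V : Type*) [NormedRing A] [StarRing A] [HopfAlgebra ℂ A]
    [AddCommGroup V] [Module ℂ V] where
  map : V →ₗ[ℂ] V ⊗[ℂ] A
  coassoc : TensorProduct.assoc ℂ V A A ∘ₗ map.rTensor A ∘ₗ map =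
    CoalgebraStruct.comul.lTensor V ∘ₗ map
  counit : TensorProduct.rid ℂ V ∘ₗ CoalgebraStruct.counit.lTensor V ∘ₗ map = LinearMap.id

namespace Corep

variable {A V W : Type*} [NormedRing A] [StarRing A] [HopfAlgebra ℂ A]
  [AddCommGroup V] [Module ℂ V] [AddCommGroup W] [Module ℂ W]

/-- `U ⊆ V` is invariant: `κ(U) ⊆ U ⊗ A`. -/
def IsInvariant (κ : Corep A V) (U : Submodule ℂ V) : Prop :=
  ∀ u ∈ U, κ.map u ∈ LinearMap.range (U.subtype.rTensor A)

/-- `V` is nonzero and has no invariant subspaces other than `0` and `V`. -/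
def IsIrreducible (κ : Corep A V) : Prop :=
  Nontrivial V ∧ ∀ U : Submodule ℂ V, κ.IsInvariant U → U = ⊥ ∨ U = ⊤

/-- There is an invertible intertwiner from `κ` to `κ'`. -/
def Equivalent (κ : Corep A V) (κ' : Corep A W) : Prop :=
  ∃ T : V ≃ₗ[ℂ] W, κ'.map ∘ₗ T.toLinearMap = T.toLinearMap.rTensor A ∘ₗ κ.map

/-- The conjugate `κ̄ : V̄ → V̄ ⊗ A` of `κ`: if `κ(e_j) = ∑ᵢ e_i ⊗ ρ_ij`, then
`κ̄(ē_j) = ∑ᵢ ē_i ⊗ ρ_ij*`. -/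
def conj [StarModule ℂ A] (κ : Corep A V) : Conj V →ₗ[ℂ] Conj V ⊗[ℂ] A :=
  (TensorProduct.map (toConj V).toLinearMap
    (starLinearEquiv ℂ (A := A)).toLinearMap).comp (κ.map.comp (toConj V).symm.toLinearMap)

/-- The Fourier transform of `a ∈ F(𝔾)` at the representation `κ`:
`â(κ) = (I ⊗ 𝓕(a)) ∘ κ̄`, a linear operator on `V̄`. -/
def fourier [StarModule ℂ A] (κ : Corep A V) (a : A) : Conj V →ₗ[ℂ] Conj V :=
  TensorProduct.rid ℂ (Conj V) ∘ₗ (dualMap A a).lTensor (Conj V) ∘ₗ κ.conj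

end Corep

/-- `(κ α)_{α ∈ ι}` is a complete family of pairwise inequivalent irreducible representations of
`𝔾`, so that `ι` is `Irr(𝔾)`. Irreducible representations of a finite quantum group are
finite-dimensional, so it is enough to let the representation space in `complete` range over the
lowest universe. -/
structure IsIrr {A ι : Type*} [NormedRing A] [StarRing A] [HopfAlgebra ℂ A]
    {V : ι → Type*} [∀ α, AddCommGroup (V α)] [∀ α, Module ℂ (V α)]
    (κ : ∀ α, Corep A (V α)) : Prop where
  irreducible : ∀ α, (κ α).IsIrreducible
  inequivalent : ∀ α β, (κ α).Equivalent (κ β) → α = β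
  complete : ∀ (W : Type) [AddCommGroup W] [Module ℂ W] (σ : Corep A W),
    σ.IsIrreducible → ∃ α, (κ α).Equivalent σ

end QuantumGroup

end

/-!
Everything rests on one functional: the normalised trace `h(a) = Tr(x ↦ a x) / dim A` of the left
regular representation of the algebra `A` (`traceState`). For a finite-dimensional C*-algebra it is
a faithful positive trace, because the eigenvalues of `x ↦ a* a x` lie in the spectrum of `a* a`.

`h` is the Haar state. The bijection `x ⊗ y ↦ Δ(x) (1 ⊗ y)` of `A ⊗ A` conjugates left
multiplication by `a ⊗ 1` into left multiplication by `Δ(a)`; comparing traces gives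
`(h ⊗ h) Δ = h` (`traceState₂_comul`). Hence `P = (I ⊗ h) Δ` is idempotent, and for `b = P(a)` the
element `x = Δ(b) - b ⊗ 1` has `(h ⊗ h)(x* x) = 0`. As `h ⊗ h` is faithful, `Δ(b) = b ⊗ 1`, so that
`b` is a scalar (`comul_eq_of_fixed`). The other side is the same. Uniqueness is formal, and the
bijectivity of `𝓕` is the faithfulness of `h`.

For the inversion formula, representations of `𝔾` are treated as modules over the convolution
algebra `ℂ𝔾`, with `φ` acting as `(I ⊗ φ) κ`. Two consequences of the invariance of `h` are used:
`x₁ h(c x₂) = S(c₁) h(c₂ x)` and `h(x₁ c) x₂ = h(x c₁) S(c₂)`.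

* As `h` is tracial, the second one shows that orthogonal complements of invariant subspaces of the
  regular representation are invariant (`act_regular_mem_orthogonal`). So `A` is semisimple, and the
  multiplicity of `V_α` in it is `dim Hom(V_α, A) = dim V_α* = d_α` by Schur's lemma and Frobenius
  reciprocity (`homRegularEquiv`). Therefore `Tr_A(φ) = ∑ d_α Tr_{V_α}(φ)` for all `φ`.
* By the first one, the operator of `φ = h(c ·)` on `A` has trace `h(c₂ S(c₁)) = h(S(c₁) c₂) = ε(c)`
  (`trace_act_regular`).

The Fourier transform `â(α)` is conjugate to the action of `h(a* ·)` on `V_α`, so the theorem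
follows by taking `c = a*` and conjugating. That `h` is tracial makes it unnecessary to know that
`S² = I`.
-/

noncomputable section

/-! ### Positivity and faithfulness of the regular trace of a C*-algebra -/

section CStar
variable {A : Type*} [CStarAlgebra A] [FiniteDimensional ℂ A]

omit [FiniteDimensional ℂ A] in
/-- Left multiplication by `a* a` has nonnegative eigenvalues only, as these lie in the spectrum of
`a* a`. -/
theorem CStarAlgebra.nonneg_of_mul_eq_smul {a x : A} {μ : ℂ} (hx : x ≠ 0)
    (h : star a * a * x = μ • x) : 0 ≤ μ := by
  have hs : μ ∈ spectrum ℂ (star a * a) := by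
    rw [spectrum.mem_iff]
    intro hu
    refine hx (hu.mul_right_eq_zero.mp ?_)
    rw [sub_mul, h, Algebra.algebraMap_eq_smul_one, smul_mul_assoc, one_mul, sub_self]
  have hsa : IsSelfAdjoint (star a * a) := IsSelfAdjoint.star_mul_self a
  have hre := hsa.mem_spectrum_eq_re hs
  rw [hre] at hs ⊢
  have := spectrum_star_mul_self_nonneg (b := a) μ.re
    (spectrum.algebraMap_mem_iff ℂ (R := ℝ) |>.mp hs)
  exact_mod_cast this

theorem CStarAlgebra.nonneg_of_mem_roots_charpoly {a : A} {μ : ℂ}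
    (h : μ ∈ (LinearMap.mulLeft ℂ (star a * a)).charpoly.roots) : 0 ≤ μ := by
  have h1 := Polynomial.isRoot_of_mem_roots h
  rw [← Module.End.hasEigenvalue_iff_isRoot_charpoly] at h1
  obtain ⟨x, hx⟩ := h1.exists_hasEigenvector
  exact nonneg_of_mul_eq_smul hx.2 hx.apply_eq_smul

theorem CStarAlgebra.trace_mulLeft_star_mul_self_nonneg (a : A) :
    0 ≤ LinearMap.trace ℂ A (LinearMap.mulLeft ℂ (star a * a)) := by
  rw [Module.End.trace_eq_sum_roots_charpoly_of_splits (IsAlgClosed.splits _)]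
  exact Multiset.sum_nonneg fun μ hμ ↦ nonneg_of_mem_roots_charpoly hμ

/-- The regular trace is faithful: if it vanishes at `a* a` then `a* a` acts nilpotently, hence is
nilpotent, and a nilpotent selfadjoint element is zero. -/
theorem CStarAlgebra.eq_zero_of_trace_mulLeft_star_mul_self {a : A}
    (h : LinearMap.trace ℂ A (LinearMap.mulLeft ℂ (star a * a)) = 0) : a = 0 := by
  rw [Module.End.trace_eq_sum_roots_charpoly_of_splits (IsAlgClosed.splits _)] at h
  set f := LinearMap.mulLeft ℂ (star a * a) with hf
  have h0 : ∀ μ ∈ f.charpoly.roots, μ = 0 := by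
    intro μ hμ
    by_contra hne
    have hpos : ∀ ν ∈ f.charpoly.roots, (0 : ℂ) ≤ ν := fun ν hν ↦
      nonneg_of_mem_roots_charpoly hν
    have := Multiset.single_le_sum hpos μ hμ
    rw [h] at this
    exact hne (le_antisymm this (hpos μ hμ))
  have hX : f.charpoly = Polynomial.X ^ f.charpoly.roots.card := by
    conv_lhs => rw [(IsAlgClosed.splits f.charpoly).eq_prod_roots_of_monic f.charpoly_monic]
    rw [Multiset.eq_replicate_card.mpr h0]
    simp
  have hnil := f.aeval_self_charpoly
  rw [hX] at hnil
  set n := f.charpoly.roots.card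
  have hn : (star a * a) ^ n = 0 := by
    rw [map_pow, Polynomial.aeval_X, hf, LinearMap.pow_mulLeft] at hnil
    simpa using LinearMap.congr_fun hnil 1
  -- `‖x ^ 2 ^ n‖ = ‖x‖ ^ 2 ^ n` for selfadjoint `x`, so a power of two is the convenient exponent
  have h2 : (star a * a) ^ 2 ^ n = 0 := pow_eq_zero_of_le Nat.lt_two_pow_self.le hn
  have h3 := (IsSelfAdjoint.star_mul_self a).nnnorm_pow_two_pow n
  rw [h2, nnnorm_zero] at h3
  have h4 : star a * a = 0 := nnnorm_eq_zero.mp (pow_eq_zero_iff (by positivity) |>.mp h3.symm)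
  exact CStarRing.star_mul_self_eq_zero_iff a |>.mp h4

end CStar

/-! ### Orthonormal bases and orthogonal complements -/

namespace InnerProductSpace.Core
variable {V : Type*} [AddCommGroup V] [Module ℂ V] [FiniteDimensional ℂ V]

theorem exists_orthonormal_basis (c : InnerProductSpace.Core ℂ V) :
    ∃ e : Module.Basis (Fin (Module.finrank ℂ V)) ℂ V,
      ∀ i j, c.inner (e i) (e j) = if i = j then 1 else 0 := by
  let : NormedAddCommGroup V := c.toNormedAddCommGroup
  let : InnerProductSpace ℂ V := .ofCore c.toCore
  refine ⟨(stdOrthonormalBasis ℂ V).toBasis, fun i j ↦ ?_⟩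
  have := orthonormal_iff_ite.mp (stdOrthonormalBasis ℂ V).orthonormal i j
  simpa using this

theorem exists_isCompl_orthogonal (c : InnerProductSpace.Core ℂ V) (U : Submodule ℂ V) :
    ∃ W : Submodule ℂ V, IsCompl U W ∧ ∀ x, x ∈ W ↔ ∀ u ∈ U, c.inner u x = 0 := by
  let : NormedAddCommGroup V := c.toNormedAddCommGroup
  let : InnerProductSpace ℂ V := .ofCore c.toCore
  exact ⟨Uᗮ, U.isCompl_orthogonal, fun x ↦
    Submodule.mem_orthogonal U x⟩

end InnerProductSpace.Core

/-! ### Representations as modules over the convolution algebra -/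

namespace QuantumGroup
open TensorProduct CoalgebraStruct

theorem eq_sum_tmul_basis {V A n : Type*} [AddCommGroup V] [Module ℂ V] [AddCommGroup A]
    [Module ℂ A] [Fintype n] (b : Module.Basis n ℂ A) (x : V ⊗[ℂ] A) :
    x = ∑ i, TensorProduct.rid ℂ V ((b.coord i).lTensor V x) ⊗ₜ b i := by
  induction x with
  | zero => simp
  | add x y hx hy =>
    simp only [map_add, add_tmul, Finset.sum_add_distrib]
    rw [← hx, ← hy]
  | tmul v a =>
    simp only [LinearMap.lTensor_tmul, rid_tmul, Module.Basis.coord_apply, smul_tmul, ← tmul_sum,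
      b.sum_repr]

namespace Corep
variable {A V W : Type*} [NormedRing A] [StarRing A] [HopfAlgebra ℂ A]
  [AddCommGroup V] [Module ℂ V] [AddCommGroup W] [Module ℂ W]
  {B : Type*} [Ring B] [Algebra ℂ B]

/-- The (right) regular representation of `𝔾`: the comultiplication of `A`. -/
def regular (A : Type*) [NormedRing A] [StarRing A] [HopfAlgebra ℂ A] : Corep A A where
  map := comul
  coassoc := Coalgebra.coassoc
  counit := by ext a; simp

/-- The operator `v ⊗ b ↦ ∑ v₀ ⊗ f(v₁) b` on `V ⊗ B`, where `κ(v) = ∑ v₀ ⊗ v₁` and `f : A → B` is a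
linear map to an algebra. For the regular representation and `f = id` it is
`x ⊗ y ↦ Δ(x) (1 ⊗ y)`. -/
def twist (κ : Corep A V) (f : A →ₗ[ℂ] B) : V ⊗[ℂ] B →ₗ[ℂ] V ⊗[ℂ] B :=
  (LinearMap.mul' ℂ B).lTensor V ∘ₗ (TensorProduct.assoc ℂ V B B).toLinearMap ∘ₗ
    (f.lTensor V ∘ₗ κ.map).rTensor B

theorem twist_tmul (κ : Corep A V) (f : A →ₗ[ℂ] B) (v : V) (b : B) :
    κ.twist f (v ⊗ₜ b) = ((LinearMap.mulRight ℂ b ∘ₗ f).lTensor V) (κ.map v) := by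
  simp only [twist, LinearMap.comp_apply, LinearMap.rTensor_tmul]
  induction κ.map v with
  | zero => simp
  | tmul v a => simp
  | add x y hx hy => simp_all [add_tmul]

/-- `f ↦ κ.twist f` is multiplicative for the convolution product. -/
theorem twist_twist (κ : Corep A V) (f g : WithConv (A →ₗ[ℂ] B)) (x : V ⊗[ℂ] B) :
    κ.twist f.ofConv (κ.twist g.ofConv x) = κ.twist (f * g).ofConv x := by
  induction x with
  | zero => simp
  | add x y hx hy => simp_all
  | tmul v b =>
    -- Both sides are the image of `(κ ⊗ I) κ v = (I ⊗ Δ) κ v` under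
    -- `L : v ⊗ a ⊗ a' ↦ v ⊗ f(a) g(a') b`.
    let L : V ⊗[ℂ] (A ⊗[ℂ] A) →ₗ[ℂ] V ⊗[ℂ] B :=
      (LinearMap.mulRight ℂ b ∘ₗ LinearMap.mul' ℂ B ∘ₗ
        TensorProduct.map f.ofConv g.ofConv).lTensor V
    have h1 : ∀ w : V ⊗[ℂ] A, κ.twist f.ofConv ((LinearMap.mulRight ℂ b ∘ₗ g.ofConv).lTensor V w) =
        L (TensorProduct.assoc ℂ V A A (κ.map.rTensor A w)) := by
      intro w
      induction w with
      | zero => simp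
      | add x y hx hy => simp_all
      | tmul v a =>
        simp only [LinearMap.lTensor_tmul, LinearMap.rTensor_tmul, twist_tmul]
        induction κ.map v with
        | zero => simp
        | add x y hx hy => simp_all [add_tmul]
        | tmul v a' => simp [L, mul_assoc]
    have h2 : ∀ w : V ⊗[ℂ] A, (LinearMap.mulRight ℂ b ∘ₗ (f * g).ofConv).lTensor V w =
        L (comul.lTensor V w) := by
      intro w
      rw [← LinearMap.comp_apply, ← LinearMap.lTensor_comp]
      rfl
    rw [twist_tmul, h1, twist_tmul, h2]
    exact congrArg L (LinearMap.congr_fun κ.coassoc v)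

/-- The operator `(I ⊗ φ) κ` on `V`. -/
def act (κ : Corep A V) (φ : Module.Dual ℂ A) : V →ₗ[ℂ] V :=
  TensorProduct.rid ℂ V ∘ₗ φ.lTensor V ∘ₗ κ.map

theorem twist_tmul_one (κ : Corep A V) (φ : Module.Dual ℂ A) (v : V) :
    κ.twist φ (v ⊗ₜ 1) = κ.act φ v ⊗ₜ 1 := by
  rw [twist_tmul, ← TensorProduct.rid_symm_apply, LinearEquiv.eq_symm_apply]
  simp [act]

theorem act_mul (κ : Corep A V) (φ ψ : WithConv (A →ₗ[ℂ] ℂ)) (v : V) :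
    κ.act (φ * ψ).ofConv v = κ.act φ.ofConv (κ.act ψ.ofConv v) := by
  have := κ.twist_twist φ ψ (v ⊗ₜ 1)
  simp only [twist_tmul_one] at this
  simpa using (congrArg (TensorProduct.rid ℂ V) this).symm

theorem act_counit (κ : Corep A V) : κ.act CoalgebraStruct.counit = LinearMap.id := κ.counit

theorem map_eq_sum {n : Type*} [Fintype n] (b : Module.Basis n ℂ A) (κ : Corep A V) (v : V) :
    κ.map v = ∑ i, κ.act (b.coord i) v ⊗ₜ b i :=
  eq_sum_tmul_basis b (κ.map v)

/-- The action of the convolution algebra `ℂ𝔾` on `V`. -/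
def actHom (κ : Corep A V) : WithConv (A →ₗ[ℂ] ℂ) →ₐ[ℂ] Module.End ℂ V :=
  AlgHom.ofLinearMap
    { toFun φ := κ.act φ.ofConv
      map_add' φ ψ := by ext v; simp [act, LinearMap.lTensor_add]
      map_smul' c φ := by ext v; simp [act, LinearMap.lTensor_smul] }
    κ.act_counit (fun φ ψ ↦ LinearMap.ext fun v ↦ κ.act_mul φ ψ v)

end Corep
end QuantumGroup

/-! ### The normalised regular trace -/

namespace QuantumGroup
open TensorProduct CoalgebraStruct

section Algebra
variable (A : Type*) [NormedRing A] [HopfAlgebra ℂ A]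

/-- The normalised trace of the left regular representation of the algebra `A`, written `h`
in comments. On a finite quantum group it is the Haar state. -/
def traceState : Module.Dual ℂ A :=
  (Module.finrank ℂ A : ℂ)⁻¹ • (LinearMap.trace ℂ A ∘ₗ LinearMap.mul ℂ A)

variable {A}

theorem traceState_apply (a : A) : traceState A a =
    (Module.finrank ℂ A : ℂ)⁻¹ * LinearMap.trace ℂ A (LinearMap.mulLeft ℂ a) := rfl

variable (A) in
theorem nontrivial_of_hopf : Nontrivial A :=
  ⟨1, 0, fun h ↦ by simpa using congrArg (counit (R := ℂ)) h⟩

variable (A) in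
/-- The functional `h ⊗ h` on `A ⊗ A`. -/
def traceState₂ : Module.Dual ℂ (A ⊗[ℂ] A) :=
  LinearMap.mul' ℂ ℂ ∘ₗ TensorProduct.map (traceState A) (traceState A)

@[simp] theorem traceState₂_tmul (a b : A) :
    traceState₂ A (a ⊗ₜ b) = traceState A a * traceState A b := rfl

end Algebra

section Hopf
variable {A : Type*} [NormedRing A] [StarRing A] [HopfAlgebra ℂ A]

/-- `x ⊗ y ↦ Δ(x) (1 ⊗ y)` intertwines left multiplication by `a ⊗ 1` and by `Δ(a)`. -/
theorem twist_regular_mul (a : A) (x : A ⊗[ℂ] A) :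
    (Corep.regular A).twist (LinearMap.id : A →ₗ[ℂ] A) ((a ⊗ₜ 1) * x) =
      comul (R := ℂ) a * (Corep.regular A).twist (LinearMap.id : A →ₗ[ℂ] A) x := by
  have key (b c : A) : (Corep.regular A).twist (LinearMap.id : A →ₗ[ℂ] A) (b ⊗ₜ c) =
      comul (R := ℂ) b * (1 ⊗ₜ c) := by
    rw [Corep.twist_tmul]
    change (LinearMap.lTensor A (LinearMap.mulRight ℂ c)) (comul b) = _
    induction comul (R := ℂ) b with
    | zero => simp
    | add x y hx hy => simp_all [add_mul]
    | tmul x y => simp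
  induction x with
  | zero => simp
  | add x y hx hy => simp_all [mul_add]
  | tmul b c =>
    rw [Algebra.TensorProduct.tmul_mul_tmul, one_mul, key, key, Bialgebra.comul_mul, mul_assoc]

/-- The inverse is the twist by the antipode, which is the convolution inverse of the identity. -/
theorem twist_regular_bijective :
    Function.Bijective ((Corep.regular A).twist (LinearMap.id : A →ₗ[ℂ] A)) := by
  have h (f g : WithConv (A →ₗ[ℂ] A)) (hfg : f * g = 1) (x : A ⊗[ℂ] A) :
      (Corep.regular A).twist f.ofConv ((Corep.regular A).twist g.ofConv x) = x := by
    rw [Corep.twist_twist, hfg]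
    induction x with
    | zero => simp
    | add x y hx hy => simp_all
    | tmul a b =>
      have : LinearMap.mulRight ℂ b ∘ₗ (1 : WithConv (A →ₗ[ℂ] A)).ofConv =
          LinearMap.toSpanSingleton ℂ A b ∘ₗ counit := by
        ext c
        simp [LinearMap.convOne_def, Algebra.smul_def]
      rw [Corep.twist_tmul, this, LinearMap.lTensor_comp, LinearMap.comp_apply]
      simp [Corep.regular]
  exact Function.bijective_iff_has_inverse.mpr ⟨_, h _ _ LinearMap.antipode_mul_id,
    h _ _ LinearMap.id_mul_antipode⟩

end Hopf

section Trace
variable (A : Type*) [NormedRing A] [StarRing A] [HopfAlgebra ℂ A]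
/-- The functions on a finite quantum group form a C*-algebra in the sense of Mathlib. -/
@[reducible]
def IsFiniteQuantumGroup.cstarAlgebra [IsFiniteQuantumGroup A] : CStarAlgebra A where
  __ := (inferInstance : Algebra ℂ A)
  norm_smul_le := norm_smul_le
  star_smul := star_smul

variable {A} [IsFiniteQuantumGroup A]

variable (A) in
theorem finrank_ne_zero : (Module.finrank ℂ A : ℂ) ≠ 0 := by
  have := nontrivial_of_hopf A
  exact_mod_cast (Module.finrank_pos (R := ℂ) (M := A)).ne'

theorem trace_mulLeft (a : A) : LinearMap.trace ℂ A (LinearMap.mulLeft ℂ a) =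
    Module.finrank ℂ A * traceState A a := by
  rw [traceState_apply, mul_inv_cancel_left₀ (finrank_ne_zero A)]

theorem traceState_one : traceState A 1 = 1 := by
  rw [traceState_apply, LinearMap.mulLeft_one, LinearMap.trace_id,
    inv_mul_cancel₀ (finrank_ne_zero A)]

theorem traceState_mul_comm (a b : A) : traceState A (a * b) = traceState A (b * a) := by
  simp only [traceState_apply, LinearMap.mulLeft_mul]
  rw [LinearMap.trace_comp_comm']

theorem traceState_nonneg (a : A) : 0 ≤ traceState A (star a * a) := by
  let _ := IsFiniteQuantumGroup.cstarAlgebra A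
  rw [traceState_apply]
  exact mul_nonneg (by simp) (CStarAlgebra.trace_mulLeft_star_mul_self_nonneg a)

theorem traceState_definite {a : A} (h : traceState A (star a * a) = 0) : a = 0 := by
  let _ := IsFiniteQuantumGroup.cstarAlgebra A
  rw [traceState_apply] at h
  exact CStarAlgebra.eq_zero_of_trace_mulLeft_star_mul_self
    ((mul_eq_zero.mp h).resolve_left (inv_ne_zero (finrank_ne_zero A)))

/-- By polarization, a positive functional is hermitian. -/
theorem traceState_star (a : A) : traceState A (star a) = starRingEnd ℂ (traceState A a) := by
  have key : ∀ b : A, (traceState A (star b * b)).im = 0 := fun b ↦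
    (Complex.nonneg_iff.mp (traceState_nonneg b)).2.symm
  have h0 := key a
  have h1 := key (1 + a)
  have h2 := key (1 + Complex.I • a)
  have e : traceState A (star (Complex.I • a) * (Complex.I • a)) = traceState A (star a * a) := by
    simp [star_smul, smul_smul]
  simp only [star_add, star_one, add_mul, mul_add, one_mul, mul_one, map_add, e] at h1 h2
  simp only [star_smul, map_smul, traceState_one, smul_eq_mul, Complex.star_def, Complex.conj_I,
    Complex.add_im, Complex.mul_im, Complex.one_im, Complex.I_re, Complex.I_im, Complex.neg_re,
    Complex.neg_im] at h1 h2
  apply Complex.ext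
  · simp only [Complex.conj_re]; linarith
  · simp only [Complex.conj_im]; linarith

variable (A) in
/-- The inner product `⟪a, b⟫ = h(a* b)` on `A`. -/
abbrev innerCore : InnerProductSpace.Core ℂ A where
  inner a b := traceState A (star a * b)
  conj_inner_symm a b := by rw [← traceState_star]; simp
  re_inner_nonneg a := (Complex.nonneg_iff.mp (traceState_nonneg a)).1
  add_left a b c := by simp [add_mul]
  smul_left a b c := by simp [star_smul]
  definite a := traceState_definite

theorem trace_mulLeft_tensor (x : A ⊗[ℂ] A) :
    LinearMap.trace ℂ (A ⊗[ℂ] A) (LinearMap.mulLeft ℂ x) =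
      Module.finrank ℂ A * (Module.finrank ℂ A * traceState₂ A x) := by
  induction x with
  | zero => simp
  | add x y hx hy =>
    have : LinearMap.mulLeft ℂ (x + y) = LinearMap.mulLeft ℂ x + LinearMap.mulLeft ℂ y :=
      LinearMap.ext fun z ↦ add_mul x y z
    rw [this, map_add, hx, hy, map_add]
    ring
  | tmul a b =>
    have : LinearMap.mulLeft ℂ (a ⊗ₜ[ℂ] b) =
        TensorProduct.map (LinearMap.mulLeft ℂ a) (LinearMap.mulLeft ℂ b) := by
      ext
      simp
    rw [this, LinearMap.trace_tensorProduct', trace_mulLeft, trace_mulLeft, traceState₂_tmul]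
    ring

theorem star_mul_tensor (x y : A ⊗[ℂ] A) : star (x * y) = star y * star x := by
  induction x with
  | zero => simp
  | add x x' hx hx' => simp [add_mul, mul_add, hx, hx']
  | tmul a b =>
    induction y with
    | zero => simp
    | add y y' hy hy' => simp [add_mul, mul_add, hy, hy']
    | tmul c d => simp

/-- The normalised trace is idempotent for convolution. -/
theorem traceState₂_comul (a : A) : traceState₂ A (comul a) = traceState A a := by
  let Φ := LinearEquiv.ofBijective _ (twist_regular_bijective (A := A))
  have h : LinearMap.mulLeft ℂ (comul (R := ℂ) a) = Φ.conj (LinearMap.mulLeft ℂ (a ⊗ₜ 1)) := by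
    rw [LinearEquiv.conj_apply, LinearEquiv.eq_comp_toLinearMap_symm]
    exact LinearMap.ext fun x ↦ (twist_regular_mul a x).symm
  have := congrArg (LinearMap.trace ℂ _) h
  rw [LinearMap.trace_conj', trace_mulLeft_tensor, trace_mulLeft_tensor, traceState₂_tmul,
    traceState_one, mul_one] at this
  have hd := finrank_ne_zero A
  exact mul_left_cancel₀ hd (mul_left_cancel₀ hd this)

end Trace
end QuantumGroup

/-! ### The Haar state -/

namespace QuantumGroup
open TensorProduct CoalgebraStruct

section Slice
variable {A : Type*} [NormedRing A] [HopfAlgebra ℂ A]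

/-- The map `(I ⊗ φ) Δ` on `A`. -/
def sliceRight (φ : Module.Dual ℂ A) : A →ₗ[ℂ] A :=
  TensorProduct.rid ℂ A ∘ₗ φ.lTensor A ∘ₗ comul

/-- The map `(φ ⊗ I) Δ` on `A`. -/
def sliceLeft (φ : Module.Dual ℂ A) : A →ₗ[ℂ] A :=
  TensorProduct.lid ℂ A ∘ₗ φ.rTensor A ∘ₗ comul

theorem apply_sliceRight (φ ψ : WithConv (A →ₗ[ℂ] ℂ)) (a : A) :
    ψ.ofConv (sliceRight φ.ofConv a) = (ψ * φ).ofConv a := by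
  simp only [sliceRight, LinearMap.comp_apply, LinearMap.convMul_def]
  induction comul (R := ℂ) a with
  | zero => simp
  | add x y hx hy => simp_all
  | tmul x y => simp [mul_comm]

theorem apply_sliceLeft (φ ψ : WithConv (A →ₗ[ℂ] ℂ)) (a : A) :
    ψ.ofConv (sliceLeft φ.ofConv a) = (φ * ψ).ofConv a := by
  simp only [sliceLeft, LinearMap.comp_apply, LinearMap.convMul_def]
  induction comul (R := ℂ) a with
  | zero => simp
  | add x y hx hy => simp_all
  | tmul x y => simp

theorem counit_sliceRight (φ : Module.Dual ℂ A) (a : A) :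
    counit (R := ℂ) (sliceRight φ a) = φ a := by
  have := apply_sliceRight (WithConv.toConv φ) 1 a
  rwa [one_mul] at this

theorem counit_sliceLeft (φ : Module.Dual ℂ A) (a : A) :
    counit (R := ℂ) (sliceLeft φ a) = φ a := by
  have := apply_sliceLeft (WithConv.toConv φ) 1 a
  rwa [mul_one] at this

theorem sliceRight_sliceRight {φ : WithConv (A →ₗ[ℂ] ℂ)} (h : φ * φ = φ) (a : A) :
    sliceRight φ.ofConv (sliceRight φ.ofConv a) = sliceRight φ.ofConv a := by
  refine Module.eval_apply_injective ℂ (LinearMap.ext fun ψ ↦ ?_)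
  calc ψ (sliceRight φ.ofConv (sliceRight φ.ofConv a))
      = (WithConv.toConv ψ * φ).ofConv (sliceRight φ.ofConv a) :=
        apply_sliceRight φ (WithConv.toConv ψ) _
    _ = (WithConv.toConv ψ * φ * φ).ofConv a := apply_sliceRight φ (WithConv.toConv ψ * φ) a
    _ = (WithConv.toConv ψ * φ).ofConv a := by rw [mul_assoc, h]
    _ = ψ (sliceRight φ.ofConv a) := (apply_sliceRight φ (WithConv.toConv ψ) a).symm

theorem sliceLeft_sliceLeft {φ : WithConv (A →ₗ[ℂ] ℂ)} (h : φ * φ = φ) (a : A) :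
    sliceLeft φ.ofConv (sliceLeft φ.ofConv a) = sliceLeft φ.ofConv a := by
  refine Module.eval_apply_injective ℂ (LinearMap.ext fun ψ ↦ ?_)
  calc ψ (sliceLeft φ.ofConv (sliceLeft φ.ofConv a))
      = (φ * WithConv.toConv ψ).ofConv (sliceLeft φ.ofConv a) :=
        apply_sliceLeft φ (WithConv.toConv ψ) _
    _ = (φ * (φ * WithConv.toConv ψ)).ofConv a := apply_sliceLeft φ (φ * WithConv.toConv ψ) a
    _ = (φ * WithConv.toConv ψ).ofConv a := by rw [← mul_assoc, h]
    _ = ψ (sliceLeft φ.ofConv a) := (apply_sliceLeft φ (WithConv.toConv ψ) a).symm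

end Slice

/-- Two Haar states `h`, `k` agree, as `(h ⊗ k) Δ` is equal to both of them. -/
theorem IsHaarState.eq {A : Type*} [NormedRing A] [StarRing A] [HopfAlgebra ℂ A]
    {h k : Module.Dual ℂ A}
    (hh : IsHaarState h) (hk : IsHaarState k) : h = k := by
  ext a
  have h1 : h (sliceRight k a) = k a := by
    rw [show sliceRight k a = k a • 1 from hk.left_invariant a, map_smul, hh.map_one, smul_eq_mul,
      mul_one]
  have h2 : k (sliceLeft h a) = h a := by
    rw [show sliceLeft h a = h a • 1 from hh.right_invariant a, map_smul, hk.map_one, smul_eq_mul,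
      mul_one]
  rw [← h1, ← h2]
  exact (apply_sliceLeft (.toConv h) (.toConv k) a).trans
    (apply_sliceRight (.toConv k) (.toConv h) a).symm

section Invariance
variable {A : Type*} [NormedRing A] [StarRing A] [HopfAlgebra ℂ A] [IsFiniteQuantumGroup A]

theorem traceState_convMul_self :
    WithConv.toConv (traceState A) * WithConv.toConv (traceState A) =
      WithConv.toConv (traceState A) :=
  WithConv.ext (LinearMap.ext traceState₂_comul)

theorem traceState₂_star (x : A ⊗[ℂ] A) :
    traceState₂ A (star x) = starRingEnd ℂ (traceState₂ A x) := by
  induction x with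
  | zero => simp
  | add x y hx hy => simp_all
  | tmul a b => simp [traceState_star]

/-- `h ⊗ h` is faithful on `A ⊗ A`: for `x = ∑ xᵢ ⊗ eᵢ` with `(eᵢ)` orthonormal,
`(h ⊗ h)(x* x) = ∑ h(xᵢ* xᵢ)`. -/
theorem traceState₂_definite {x : A ⊗[ℂ] A} (h : traceState₂ A (star x * x) = 0) : x = 0 := by
  obtain ⟨e, he⟩ := (innerCore A).exists_orthonormal_basis
  replace he : ∀ i j, traceState A (star (e i) * e j) = if i = j then 1 else 0 := he
  obtain ⟨y, rfl⟩ : ∃ y : Fin (Module.finrank ℂ A) → A, x = ∑ i, y i ⊗ₜ e i :=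
    ⟨_, eq_sum_tmul_basis e x⟩
  have h1 : ∑ i, traceState A (star (y i) * y i) = 0 := by
    simpa [Finset.sum_mul, Finset.mul_sum, he] using h
  rw [Finset.sum_eq_zero_iff_of_nonneg fun i _ ↦ traceState_nonneg (y i)] at h1
  exact Finset.sum_eq_zero fun i hi ↦ by rw [traceState_definite (h1 i hi), zero_tmul]

/-- `j` stands for one of the two inclusions `A → A ⊗ A` and `P` for the corresponding slice of the
comultiplication by `h`; it satisfies `(h ⊗ h)(j(x) Δ(y)) = h(x P(y))`. A fixed point `b` of `P`
satisfies `Δ(b) = j(b)`, since `(h ⊗ h)((Δ(b) - j(b))* (Δ(b) - j(b))) = 0`. -/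
theorem comul_eq_of_fixed (j : A → A ⊗[ℂ] A) (P : A → A)
    (hstar : ∀ x, star (j x) = j (star x)) (hmul : ∀ x y, j (x * y) = j x * j y)
    (hj : ∀ x, traceState₂ A (j x) = traceState A x)
    (hP : ∀ x y, traceState₂ A (j x * comul y) = traceState A (x * P y))
    {b : A} (hb : P b = b) : comul b = j b := by
  rw [← sub_eq_zero]
  apply traceState₂_definite
  have h1 : traceState₂ A (star (j b) * comul b) = traceState A (star b * b) := by
    rw [hstar, hP, hb]
  have h2 : traceState₂ A (star (comul b) * j b) = traceState A (star b * b) := by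
    have : star (comul (R := ℂ) b) * j b = star (star (j b) * comul b) := by
      rw [star_mul_tensor, star_star]
    rw [this, traceState₂_star, h1, ← traceState_star]
    simp
  have h3 : traceState₂ A (star (comul b) * comul b) = traceState A (star b * b) := by
    rw [← IsFiniteQuantumGroup.comul_star, ← Bialgebra.comul_mul, traceState₂_comul]
  have h4 : traceState₂ A (star (j b) * j b) = traceState A (star b * b) := by
    rw [hstar, ← hmul, hj]
  simp [sub_mul, mul_sub, h1, h2, h3, h4]

theorem sliceRight_traceState (a : A) : sliceRight (traceState A) a = traceState A a • 1 := by
  set b := sliceRight (traceState A) a with hb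
  have hΔ : comul b = b ⊗ₜ[ℂ] (1 : A) := by
    refine comul_eq_of_fixed (fun x ↦ x ⊗ₜ 1) (sliceRight (traceState A)) (by simp) (by simp)
      (by simp [traceState_one]) (fun x y ↦ ?_) (sliceRight_sliceRight traceState_convMul_self a)
    simp only [sliceRight, LinearMap.comp_apply]
    induction comul (R := ℂ) y with
    | zero => simp
    | add x y hx hy => simp_all [mul_add]
    | tmul x y => simp [mul_comm]
  -- applying `ε ⊗ I` to `Δ(b) = b ⊗ 1` gives `b = ε(b) 1`, and `ε(b) = h(a)`
  have := congrArg (fun x ↦ TensorProduct.lid ℂ A (counit.rTensor A x)) hΔ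
  simp only [Coalgebra.rTensor_counit_comul] at this
  rw [hb, ← counit_sliceRight, ← hb]
  simpa using this

theorem sliceLeft_traceState (a : A) : sliceLeft (traceState A) a = traceState A a • 1 := by
  set b := sliceLeft (traceState A) a with hb
  have hΔ : comul b = (1 : A) ⊗ₜ[ℂ] b := by
    refine comul_eq_of_fixed (fun x ↦ 1 ⊗ₜ x) (sliceLeft (traceState A)) (by simp) (by simp)
      (by simp [traceState_one]) (fun x y ↦ ?_) (sliceLeft_sliceLeft traceState_convMul_self a)
    simp only [sliceLeft, LinearMap.comp_apply]
    induction comul (R := ℂ) y with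
    | zero => simp
    | add x y hx hy => simp_all [mul_add]
    | tmul x y => simp
  have := congrArg (fun x ↦ TensorProduct.rid ℂ A (counit.lTensor A x)) hΔ
  simp only [Coalgebra.lTensor_counit_comul] at this
  rw [hb, ← counit_sliceLeft, ← hb]
  simpa using this

theorem isHaarState_traceState : IsHaarState (traceState A) where
  map_one := traceState_one
  nonneg := traceState_nonneg
  left_invariant := sliceRight_traceState
  right_invariant := sliceLeft_traceState

theorem haar_eq_traceState : haar A = traceState A :=
  (Classical.epsilon_spec (p := fun h : Module.Dual ℂ A ↦ IsHaarState h)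
    ⟨_, isHaarState_traceState⟩).eq isHaarState_traceState

theorem dualMap_apply (a b : A) : dualMap A a b = traceState A (b * a) := by
  rw [← haar_eq_traceState]; rfl

theorem dualMap_bijective : Function.Bijective (dualMap A) := by
  have hinj : Function.Injective (dualMap A) := by
    rw [injective_iff_map_eq_zero]
    intro a ha
    apply traceState_definite
    rw [← dualMap_apply, ha, LinearMap.zero_apply]
  exact ⟨hinj, (LinearMap.injective_iff_surjective_of_finrank_eq_finrank
    Subspace.dual_finrank_eq.symm).mp hinj⟩

/-- The counit is a `*`-homomorphism, as `a ↦ conj (ε(a*))` is a counit too. -/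
theorem counit_star (a : A) : counit (R := ℂ) (star a) = starRingEnd ℂ (counit (R := ℂ) a) := by
  let ε' : Module.Dual ℂ A :=
    { toFun a := starRingEnd ℂ (counit (R := ℂ) (star a))
      map_add' := by simp
      map_smul' := by simp }
  have h (a : A) : sliceLeft ε' a = a := by
    have : ∀ x : A ⊗[ℂ] A, TensorProduct.lid ℂ A (ε'.rTensor A x) =
        star (TensorProduct.lid ℂ A ((counit (R := ℂ)).rTensor A (star x))) := by
      intro x
      induction x with
      | zero => simp
      | add x y hx hy => simp_all
      | tmul x y => simp [ε', star_smul]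
    change TensorProduct.lid ℂ A (ε'.rTensor A (comul a)) = a
    rw [this, ← IsFiniteQuantumGroup.comul_star, Coalgebra.rTensor_counit_comul]
    simp
  have := counit_sliceLeft ε' a
  rw [h] at this
  simpa [ε'] using (congrArg (starRingEnd ℂ) this).symm

end Invariance
end QuantumGroup

/-! ### Strong invariance -/

namespace QuantumGroup
open TensorProduct CoalgebraStruct

section StrongInvariance
variable {A : Type*} [NormedRing A] [StarRing A] [HopfAlgebra ℂ A] [IsFiniteQuantumGroup A]

/-- The map `c ↦ h(c x) 1`, as an element of the convolution algebra of linear maps `A → A`. -/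
def haarMulLeft (x : A) : WithConv (A →ₗ[ℂ] A) :=
  .toConv (LinearMap.toSpanSingleton ℂ A 1 ∘ₗ traceState A ∘ₗ LinearMap.mulRight ℂ x)

/-- The map `c ↦ h(x c) 1`, as an element of the convolution algebra of linear maps `A → A`. -/
def haarMulRight (x : A) : WithConv (A →ₗ[ℂ] A) :=
  .toConv (LinearMap.toSpanSingleton ℂ A 1 ∘ₗ traceState A ∘ₗ LinearMap.mulLeft ℂ x)

/-- Strong left invariance `x₁ h(c x₂) = S(c₁) h(c₂ x)`. As functions of `c`, call the two sides `G`
and `S * F` with `F(c) = h(c x) 1`; the invariance of `h` says that `I * G = F` for the convolution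
product. -/
theorem sliceRight_mulLeft (c x : A) :
    sliceRight (traceState A ∘ₗ LinearMap.mulLeft ℂ c) x =
      (WithConv.toConv (HopfAlgebra.antipode ℂ (A := A)) * haarMulLeft x).ofConv c := by
  let G : WithConv (A →ₗ[ℂ] A) := .toConv
    { toFun c := sliceRight (traceState A ∘ₗ LinearMap.mulLeft ℂ c) x
      map_add' c d := by
        have : LinearMap.mulLeft ℂ (c + d) = LinearMap.mulLeft ℂ c + LinearMap.mulLeft ℂ d :=
          LinearMap.ext fun z ↦ add_mul c d z
        rw [this]
        simp [sliceRight, LinearMap.comp_add, LinearMap.lTensor_add]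
      map_smul' r c := by
        have : LinearMap.mulLeft ℂ (r • c) = r • LinearMap.mulLeft ℂ c :=
          LinearMap.ext fun z ↦ smul_mul_assoc r c z
        rw [this]
        simp [sliceRight, LinearMap.comp_smul, LinearMap.lTensor_smul] }
  have hG : WithConv.toConv LinearMap.id * G = haarMulLeft x := by
    ext c
    have h1 : ∀ w : A ⊗[ℂ] A, LinearMap.mul' ℂ A (TensorProduct.map LinearMap.id G.ofConv w) =
        TensorProduct.rid ℂ A ((traceState A).lTensor A (w * comul x)) := by
      intro w
      induction w with
      | zero => simp
      | add w w' hw hw' => simp_all [add_mul]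
      | tmul a b =>
        simp only [G, sliceRight, LinearMap.comp_apply, TensorProduct.map_tmul, LinearMap.coe_mk,
          AddHom.coe_mk, LinearMap.mul'_apply, LinearMap.id_apply]
        induction comul (R := ℂ) x with
        | zero => simp
        | add w w' hw hw' => simp_all [mul_add]
        | tmul p q => simp
    rw [LinearMap.convMul_def]
    simp only [LinearMap.comp_apply]
    rw [h1, ← Bialgebra.comul_mul]
    exact sliceRight_traceState (c * x)
  have : G = WithConv.toConv (HopfAlgebra.antipode ℂ) * haarMulLeft x := by
    rw [← hG, ← mul_assoc, LinearMap.antipode_mul_id, one_mul]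
  rw [← this]
  rfl

/-- Strong right invariance `h(x₁ c) x₂ = h(x c₁) S(c₂)`. As functions of `c`, call the two sides
`G` and `F * S` with `F(c) = h(x c) 1`; the invariance of `h` says that `G * I = F` for the
convolution product. -/
theorem sliceLeft_mulRight (c x : A) :
    sliceLeft (traceState A ∘ₗ LinearMap.mulRight ℂ c) x =
      (haarMulRight x * WithConv.toConv (HopfAlgebra.antipode ℂ (A := A))).ofConv c := by
  let G : WithConv (A →ₗ[ℂ] A) := .toConv
    { toFun c := sliceLeft (traceState A ∘ₗ LinearMap.mulRight ℂ c) x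
      map_add' c d := by
        have : LinearMap.mulRight ℂ (c + d) = LinearMap.mulRight ℂ c + LinearMap.mulRight ℂ d :=
          LinearMap.ext fun z ↦ mul_add z c d
        rw [this]
        simp [sliceLeft, LinearMap.comp_add, LinearMap.rTensor_add]
      map_smul' r c := by
        have : LinearMap.mulRight ℂ (r • c) = r • LinearMap.mulRight ℂ c :=
          LinearMap.ext fun z ↦ mul_smul_comm r z c
        rw [this]
        simp [sliceLeft, LinearMap.comp_smul, LinearMap.rTensor_smul] }
  have hG : G * WithConv.toConv LinearMap.id = haarMulRight x := by
    ext c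
    have h1 : ∀ w : A ⊗[ℂ] A, LinearMap.mul' ℂ A (TensorProduct.map G.ofConv LinearMap.id w) =
        TensorProduct.lid ℂ A ((traceState A).rTensor A (comul x * w)) := by
      intro w
      induction w with
      | zero => simp
      | add w w' hw hw' => simp_all [mul_add]
      | tmul a b =>
        simp only [G, sliceLeft, LinearMap.comp_apply, TensorProduct.map_tmul, LinearMap.coe_mk,
          AddHom.coe_mk, LinearMap.mul'_apply, LinearMap.id_apply]
        induction comul (R := ℂ) x with
        | zero => simp
        | add w w' hw hw' => simp_all [add_mul]
        | tmul p q => simp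
    rw [LinearMap.convMul_def]
    simp only [LinearMap.comp_apply]
    rw [h1, ← Bialgebra.comul_mul]
    exact sliceLeft_traceState (x * c)
  have : G = haarMulRight x * WithConv.toConv (HopfAlgebra.antipode ℂ) := by
    rw [← hG, mul_assoc, LinearMap.id_mul_antipode, mul_one]
  rw [← this]
  rfl

/-- The regular representation takes the functional `h(c ·)` to an operator of trace `ε(c)`.
The operator is `x ↦ S(c₁) h(c₂ x)`, of trace `h(c₂ S(c₁)) = h(S(c₁) c₂) = ε(c)`. -/
theorem trace_act_regular (c : A) :
    LinearMap.trace ℂ A ((Corep.regular A).act (traceState A ∘ₗ LinearMap.mulLeft ℂ c)) =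
      counit (R := ℂ) c := by
  -- the operator `x ↦ S(b) h(d x)` attached to `b ⊗ d`
  let R : A ⊗[ℂ] A →ₗ[ℂ] Module.End ℂ A :=
    TensorProduct.lift (LinearMap.mk₂ ℂ (fun b d ↦
      LinearMap.toSpanSingleton ℂ A (HopfAlgebra.antipode ℂ b) ∘ₗ
        traceState A ∘ₗ LinearMap.mulLeft ℂ d)
      (fun b b' d ↦ by ext; simp) (fun r b d ↦ by ext; simp [smul_comm r])
      (fun b d d' ↦ by ext; simp [add_mul, add_smul]) (fun r b d ↦ by ext; simp [mul_smul]))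
  have h1 : (Corep.regular A).act (traceState A ∘ₗ LinearMap.mulLeft ℂ c) = R (comul c) := by
    ext x
    have h : ∀ w : A ⊗[ℂ] A,
        LinearMap.mul' ℂ A (TensorProduct.map (HopfAlgebra.antipode ℂ) (haarMulLeft x).ofConv w) =
          R w x := by
      intro w
      induction w with
      | zero => simp
      | add w w' hw hw' => simp_all
      | tmul b d => simp [R, haarMulLeft]
    exact (sliceRight_mulLeft c x).trans (h _)
  have h2 : ∀ w : A ⊗[ℂ] A, LinearMap.trace ℂ A (R w) = traceState A
      (LinearMap.mul' ℂ A (TensorProduct.map (HopfAlgebra.antipode ℂ) LinearMap.id w)) := by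
    intro w
    induction w with
    | zero => simp
    | add w w' hw hw' => simp_all
    | tmul b d =>
      simp only [R, TensorProduct.lift.tmul, LinearMap.mk₂_apply]
      rw [LinearMap.trace_comp_comm']
      have : (traceState A ∘ₗ LinearMap.mulLeft ℂ d) ∘ₗ
          LinearMap.toSpanSingleton ℂ A (HopfAlgebra.antipode ℂ b) =
          traceState A (d * HopfAlgebra.antipode ℂ b) • LinearMap.id := by
        ext; simp
      rw [this, map_smul, LinearMap.trace_id]
      simp [traceState_mul_comm d]
  have h3 : LinearMap.mul' ℂ A (TensorProduct.map (HopfAlgebra.antipode ℂ) LinearMap.id (comul c)) =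
      algebraMap ℂ A (counit c) := HopfAlgebra.mul_antipode_rTensor_comul_apply c
  rw [h1, h2, h3, Algebra.algebraMap_eq_smul_one, map_smul, traceState_one, smul_eq_mul, mul_one]

/-- Orthogonal complements of invariant subspaces are invariant: `h` being tracial,
`h(u* x₁) x₂ = h(x u*₁) S(u*₂)`. -/
theorem act_regular_mem_orthogonal {U : Submodule ℂ A} (hU : (Corep.regular A).IsInvariant U)
    {x : A} (hx : ∀ u ∈ U, traceState A (star u * x) = 0) (φ : Module.Dual ℂ A) {u : A}
    (hu : u ∈ U) : traceState A (star u * (Corep.regular A).act φ x) = 0 := by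
  have h1 : traceState A (star u * (Corep.regular A).act φ x) =
      φ (sliceLeft (traceState A ∘ₗ LinearMap.mulRight ℂ (star u)) x) := by
    change traceState A (star u * sliceRight φ x) = _
    simp only [sliceRight, sliceLeft, LinearMap.comp_apply]
    induction comul (R := ℂ) x with
    | zero => simp
    | add w w' hw hw' => simp_all [mul_add]
    | tmul p q => simp [traceState_mul_comm p, mul_comm]
  obtain ⟨w, hw⟩ := hU u hu
  have hw' : comul (R := ℂ) (star u) = star (U.subtype.rTensor A w) := by
    rw [hw, IsFiniteQuantumGroup.comul_star]
    rfl
  -- `Δ(u*)` lies in `U* ⊗ A`, and `h(x u'*) = h(u'* x) = 0` for `u' ∈ U`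
  have h2 : ∀ w : U ⊗[ℂ] A, LinearMap.mul' ℂ A (TensorProduct.map (haarMulRight x).ofConv
      (HopfAlgebra.antipode ℂ) (star (U.subtype.rTensor A w))) = 0 := by
    intro w
    induction w with
    | zero => simp
    | add w w' hw hw' => simp_all
    | tmul p q => simp [haarMulRight, traceState_mul_comm x, hx p p.2]
  rw [h1, sliceLeft_mulRight, LinearMap.convMul_apply, hw']
  exact (congrArg φ (h2 w)).trans (map_zero φ)

end StrongInvariance
end QuantumGroup

/-! ### Multiplicities and traces in semisimple modules -/

section HomSpaces
variable {k R N : Type*} [Field k] [Ring R] [Algebra k R] [AddCommGroup N] [Module k N] [Module R N]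
  [IsScalarTower k R N]

/-- Linear maps into a product are families of linear maps. -/
def LinearMap.piLinearEquiv {J : Type*} (S : J → Type*) [∀ j, AddCommGroup (S j)]
    [∀ j, Module k (S j)] [∀ j, Module R (S j)] [∀ j, IsScalarTower k R (S j)] :
    (N →ₗ[R] ∀ j, S j) ≃ₗ[k] ∀ j, N →ₗ[R] S j where
  toFun f j := LinearMap.proj j ∘ₗ f
  invFun f := LinearMap.pi f
  map_add' _ _ := rfl
  map_smul' _ _ := rfl
  left_inv _ := rfl
  right_inv _ := rfl

/-- Postcomposition with a linear equivalence. -/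
def LinearEquiv.postcomp {M M' : Type*} [AddCommGroup M] [Module k M] [Module R M]
    [IsScalarTower k R M] [AddCommGroup M'] [Module k M'] [Module R M'] [IsScalarTower k R M']
    (e : M ≃ₗ[R] M') : (N →ₗ[R] M) ≃ₗ[k] (N →ₗ[R] M') where
  toFun f := e.toLinearMap ∘ₗ f
  invFun f := e.symm.toLinearMap ∘ₗ f
  map_add' f g := by ext; simp
  map_smul' c f := LinearMap.ext fun x ↦ e.toLinearMap.map_smul_of_tower c (f x)
  left_inv f := by ext; simp
  right_inv f := by ext; simp

theorem IsSimpleModule.finrank_hom_eq_one [IsAlgClosed k] [FiniteDimensional k N]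
    [IsSimpleModule R N] {M : Type*} [AddCommGroup M] [Module k M] [Module R M]
    [IsScalarTower k R M] (e : N ≃ₗ[R] M) : Module.finrank k (N →ₗ[R] M) = 1 := by
  have := IsSimpleModule.nontrivial R N
  rw [(e.symm.postcomp (k := k) (N := N)).finrank_eq,
    ← (LinearEquiv.ofBijective (Algebra.linearMap k (Module.End R N))
      (IsSimpleModule.algebraMap_end_bijective_of_isAlgClosed k)).finrank_eq, Module.finrank_self]

open Classical in
/-- The dimension of the space of homomorphisms from a simple module to a direct sum of simple
modules counts the summands that are isomorphic to it. -/
theorem finrank_hom_isInternal [IsAlgClosed k] [FiniteDimensional k N] [IsSimpleModule R N]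
    {M J : Type*} [Fintype J] [DecidableEq J] [AddCommGroup M] [Module k M] [Module R M]
    [IsScalarTower k R M] [FiniteDimensional k M]
    {S : J → Submodule R M} (hS : DirectSum.IsInternal S) (hsimple : ∀ j, IsSimpleModule R (S j)) :
    Module.finrank k (N →ₗ[R] M) = ∑ j, if Nonempty (N ≃ₗ[R] S j) then 1 else 0 := by
  let e : M ≃ₗ[R] ∀ j, S j := (LinearEquiv.ofBijective (DirectSum.coeLinearMap S) hS).symm ≪≫ₗ
    DirectSum.linearEquivFunOnFintype R J fun j ↦ S j
  have (j : J) : Module.Finite k (N →ₗ[R] S j) :=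
    have : Module.Finite k (S j) := .of_injective ((S j).subtype.restrictScalars k)
      (S j).injective_subtype
    .of_injective (LinearMap.restrictScalarsₗ k R N (S j) k) (LinearMap.restrictScalars_injective _)
  rw [(e.postcomp (k := k)).finrank_eq, (LinearMap.piLinearEquiv (k := k) _).finrank_eq,
    Module.finrank_pi_fintype]
  refine Finset.sum_congr rfl fun j _ ↦ ?_
  split_ifs with h
  · exact IsSimpleModule.finrank_hom_eq_one h.some
  · have := hsimple j
    have : Subsingleton (N →ₗ[R] S j) := ⟨fun f g ↦ by
      have h0 (f : N →ₗ[R] S j) : f = 0 := f.bijective_or_eq_zero.resolve_left fun hf ↦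
        h ⟨.ofBijective f hf⟩
      rw [h0 f, h0 g]⟩
    exact Module.finrank_zero_of_subsingleton

theorem trace_lsmul_eq_of_equiv {M : Type*} [AddCommGroup M] [Module k M] [Module R M]
    [IsScalarTower k R M] (e : N ≃ₗ[R] M) (r : R) :
    LinearMap.trace k M (Algebra.lsmul k k M r) = LinearMap.trace k N (Algebra.lsmul k k N r) := by
  rw [← LinearMap.trace_conj' (Algebra.lsmul k k N r) (e.restrictScalars k)]
  congr 1
  ext x
  simp

theorem trace_lsmul_eq_sum {M J : Type*} [Fintype J] [DecidableEq J] [AddCommGroup M] [Module k M]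
    [Module R M] [IsScalarTower k R M] [FiniteDimensional k M] {S : J → Submodule R M}
    (hS : DirectSum.IsInternal S) (r : R) :
    LinearMap.trace k M (Algebra.lsmul k k M r) =
      ∑ j, LinearMap.trace k (S j) (Algebra.lsmul k k (S j) r) :=
  LinearMap.trace_eq_sum_trace_restrict (N := fun j ↦ (S j).restrictScalars k) hS
    fun j _ hx ↦ (S j).smul_mem r hx

end HomSpaces

/-! ### Irreducible representations as simple modules -/

namespace QuantumGroup
open TensorProduct CoalgebraStruct

namespace Corep
variable {A V W : Type*} [NormedRing A] [StarRing A] [HopfAlgebra ℂ A]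
  [AddCommGroup V] [Module ℂ V] [AddCommGroup W] [Module ℂ W]

theorem rid_lTensor_rTensor {A V W : Type*} [AddCommGroup A] [Module ℂ A] [AddCommGroup V]
    [Module ℂ V] [AddCommGroup W] [Module ℂ W] (φ : Module.Dual ℂ A) (T : V →ₗ[ℂ] W)
    (x : V ⊗[ℂ] A) :
    TensorProduct.rid ℂ W (φ.lTensor W (T.rTensor A x)) =
      T (TensorProduct.rid ℂ V (φ.lTensor V x)) := by
  induction x with
  | zero => simp
  | add x y hx hy => simp_all
  | tmul v a => simp

theorem isInvariant_iff [Module.Finite ℂ A] {κ : Corep A V} {U : Submodule ℂ V} :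
    κ.IsInvariant U ↔ ∀ φ : Module.Dual ℂ A, ∀ u ∈ U, κ.act φ u ∈ U := by
  constructor
  · intro h φ u hu
    obtain ⟨w, hw⟩ := h u hu
    have : ∀ w : U ⊗[ℂ] A, TensorProduct.rid ℂ V (φ.lTensor V (U.subtype.rTensor A w)) ∈ U := by
      intro w
      induction w with
      | zero => simp
      | add w w' hw hw' => simpa using U.add_mem hw hw'
      | tmul p q => simpa using U.smul_mem _ p.2
    simpa [hw] using! this w
  · intro h u hu
    let b := Module.finBasis ℂ A
    exact ⟨∑ i, ⟨κ.act (b.coord i) u, h _ u hu⟩ ⊗ₜ b i, by simp [← κ.map_eq_sum b]⟩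

/-- The space `V`, as a module over the convolution algebra `ℂ𝔾`, with `φ` acting as `(I ⊗ φ) κ`. -/
def Mod (_ : Corep A V) : Type _ := V

instance (κ : Corep A V) : AddCommGroup κ.Mod := inferInstanceAs (AddCommGroup V)
instance (κ : Corep A V) : Module ℂ κ.Mod := inferInstanceAs (Module ℂ V)
instance (κ : Corep A V) [h : FiniteDimensional ℂ V] : FiniteDimensional ℂ κ.Mod := h
instance (κ : Corep A V) : Module (WithConv (A →ₗ[ℂ] ℂ)) κ.Mod :=
  Module.compHom V κ.actHom.toRingHom

theorem smul_def (κ : Corep A V) (φ : WithConv (A →ₗ[ℂ] ℂ)) (v : κ.Mod) :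
    φ • v = κ.act φ.ofConv v := rfl

instance (κ : Corep A V) : IsScalarTower ℂ (WithConv (A →ₗ[ℂ] ℂ)) κ.Mod where
  smul_assoc c φ v := LinearMap.congr_fun (map_smul κ.actHom c φ) v

theorem isIrreducible_iff [Module.Finite ℂ A] {κ : Corep A V} :
    κ.IsIrreducible ↔ IsSimpleModule (WithConv (A →ₗ[ℂ] ℂ)) κ.Mod := by
  constructor
  · rintro ⟨hn, h⟩
    have : Nontrivial κ.Mod := hn
    refine { eq_bot_or_eq_top N := ?_ }
    refine (h (N.restrictScalars ℂ) (isInvariant_iff.mpr fun φ u hu ↦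
      N.smul_mem (.toConv φ) hu)).imp (fun h ↦ ?_) (fun h ↦ ?_)
    · exact (Submodule.restrictScalars_eq_bot_iff ℂ _ _).mp h
    · exact (Submodule.restrictScalars_eq_top_iff ℂ _ _).mp h
  · intro h
    refine ⟨IsSimpleModule.nontrivial (WithConv (A →ₗ[ℂ] ℂ)) κ.Mod, fun U hU ↦ ?_⟩
    let N : Submodule (WithConv (A →ₗ[ℂ] ℂ)) κ.Mod :=
      { U.toAddSubmonoid with smul_mem' φ u hu := isInvariant_iff.mp hU φ.ofConv u hu }
    refine (eq_bot_or_eq_top N).imp (fun h ↦ ?_) (fun h ↦ ?_)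
    · exact SetLike.ext fun x ↦ SetLike.ext_iff.mp h x
    · exact SetLike.ext fun x ↦ SetLike.ext_iff.mp h x

theorem equivalent_iff [Module.Finite ℂ A] {κ : Corep A V} {σ : Corep A W} :
    κ.Equivalent σ ↔ Nonempty (κ.Mod ≃ₗ[WithConv (A →ₗ[ℂ] ℂ)] σ.Mod) := by
  constructor
  · rintro ⟨T, hT⟩
    refine ⟨{ T with map_smul' φ v := ?_ }⟩
    change T (κ.act φ.ofConv v) = σ.act φ.ofConv (T v)
    have h := congrArg (fun w ↦ TensorProduct.rid ℂ W (φ.ofConv.lTensor W w))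
      (LinearMap.congr_fun hT v)
    exact ((rid_lTensor_rTensor φ.ofConv T.toLinearMap (κ.map v)).symm.trans h.symm)
  · rintro ⟨T⟩
    let T' : V ≃ₗ[ℂ] W := T.restrictScalars ℂ
    refine ⟨T', LinearMap.ext fun v ↦ ?_⟩
    let b := Module.finBasis ℂ A
    have h (i) : T' (κ.act (b.coord i) v) = σ.act (b.coord i) (T' v) :=
      T.map_smul (.toConv (b.coord i)) v
    change σ.map (T' v) = T'.toLinearMap.rTensor A (κ.map v)
    rw [map_eq_sum b, κ.map_eq_sum b, map_sum]
    exact Finset.sum_congr rfl fun i _ ↦ by rw [← h]; rfl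

/-- An irreducible representation is a cyclic module over the finite-dimensional algebra `ℂ𝔾`. -/
theorem IsIrreducible.finiteDimensional [Module.Finite ℂ A] {κ : Corep A V}
    (h : κ.IsIrreducible) : FiniteDimensional ℂ V := by
  have := isIrreducible_iff.mp h
  have : Module.Finite ℂ (WithConv (A →ₗ[ℂ] ℂ)) :=
    .equiv (WithConv.linearEquiv ℂ (A →ₗ[ℂ] ℂ)).symm
  exact Module.Finite.trans (R := ℂ) (WithConv (A →ₗ[ℂ] ℂ)) κ.Mod

/-- The representation on `W` obtained from a representation on `V ⊇ W`; here `f` is the inclusion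
and `g` a linear retraction, with `κ(W) ⊆ W ⊗ A`. -/
def restrict (κ : Corep A V) (f : W →ₗ[ℂ] V) (g : V →ₗ[ℂ] W) (hgf : g ∘ₗ f = LinearMap.id)
    (h : f.rTensor A ∘ₗ g.rTensor A ∘ₗ κ.map ∘ₗ f = κ.map ∘ₗ f) : Corep A W where
  map := g.rTensor A ∘ₗ κ.map ∘ₗ f
  coassoc := by
    have e1 (x : V ⊗[ℂ] A) : TensorProduct.assoc ℂ W A A (((g.rTensor A ∘ₗ κ.map).rTensor A) x) =
        g.rTensor (A ⊗[ℂ] A) (TensorProduct.assoc ℂ V A A (κ.map.rTensor A x)) := by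
      induction x with
      | zero => simp
      | add x y hx hy => simp_all
      | tmul v a =>
        simp only [LinearMap.rTensor_tmul, LinearMap.comp_apply]
        induction κ.map v with
        | zero => simp
        | add x y hx hy => simp_all [add_tmul]
        | tmul v' a' => simp
    have e2 (x : V ⊗[ℂ] A) : g.rTensor (A ⊗[ℂ] A) ((comul (R := ℂ)).lTensor V x) =
        (comul (R := ℂ)).lTensor W (g.rTensor A x) := by
      induction x with
      | zero => simp
      | add x y hx hy => simp_all
      | tmul v a => simp
    ext w
    have h1 : f.rTensor A (g.rTensor A (κ.map (f w))) = κ.map (f w) := LinearMap.congr_fun h w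
    have h2 : TensorProduct.assoc ℂ V A A (κ.map.rTensor A (κ.map (f w))) =
        (comul (R := ℂ)).lTensor V (κ.map (f w)) := LinearMap.congr_fun κ.coassoc (f w)
    simp only [LinearMap.comp_apply, LinearEquiv.coe_coe]
    rw [← e2, ← h2, ← e1]
    conv_rhs => rw [← h1, ← LinearMap.comp_apply, ← LinearMap.rTensor_comp]
    rfl
  counit := by
    ext w
    exact (rid_lTensor_rTensor _ g _).trans ((congrArg g (LinearMap.congr_fun κ.counit (f w))).trans
      (LinearMap.congr_fun hgf w))

theorem restrict_act (κ : Corep A V) (f : W →ₗ[ℂ] V) (g : V →ₗ[ℂ] W) (hgf h)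
    (φ : Module.Dual ℂ A) (w : W) : f ((κ.restrict f g hgf h).act φ w) = κ.act φ (f w) := by
  refine (rid_lTensor_rTensor φ f _).symm.trans ?_
  exact congrArg (fun x ↦ TensorProduct.rid ℂ V (φ.lTensor V x)) (LinearMap.congr_fun h w)

/-- A submodule of `V` over the convolution algebra comes from a representation of `𝔾`, on a
space in the lowest universe. -/
theorem exists_mod_equiv [Module.Finite ℂ A] [FiniteDimensional ℂ V] (κ : Corep A V)
    (S : Submodule (WithConv (A →ₗ[ℂ] ℂ)) κ.Mod) :
    ∃ (n : ℕ) (σ : Corep A (Fin n → ℂ)), Nonempty (σ.Mod ≃ₗ[WithConv (A →ₗ[ℂ] ℂ)] S) := by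
  let U : Submodule ℂ V := S.restrictScalars ℂ
  let e : (Fin (Module.finrank ℂ U) → ℂ) ≃ₗ[ℂ] U := (Module.finBasis ℂ U).equivFun.symm
  let f : (Fin (Module.finrank ℂ U) → ℂ) →ₗ[ℂ] V := U.subtype ∘ₗ e.toLinearMap
  obtain ⟨g, hg⟩ := f.exists_leftInverse_of_injective
    (LinearMap.ker_eq_bot.mpr (U.injective_subtype.comp e.injective))
  have hfg (u : V) (hu : u ∈ U) : f (g u) = u := by
    have h1 : f (e.symm ⟨u, hu⟩) = u := by simp [f]
    rw [← h1]
    exact congrArg f (LinearMap.congr_fun hg _)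
  let b := Module.finBasis ℂ A
  have h : f.rTensor A ∘ₗ g.rTensor A ∘ₗ κ.map ∘ₗ f = κ.map ∘ₗ f := by
    refine LinearMap.ext fun w ↦ ?_
    simp only [LinearMap.comp_apply]
    rw [κ.map_eq_sum b]
    simp only [map_sum, LinearMap.rTensor_tmul]
    exact Finset.sum_congr rfl fun i _ ↦ by
      rw [hfg (κ.act (b.coord i) (f w)) (S.smul_mem (.toConv (b.coord i)) (e w).2)]
  exact ⟨_, κ.restrict f g hg h,
    ⟨{ e with map_smul' φ w := Subtype.ext (κ.restrict_act f g hg h φ.ofConv w) }⟩⟩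

/-- The matrix coefficients `(l ⊗ I) κ(v)` of a representation. -/
def coeff (κ : Corep A V) (l : Module.Dual ℂ V) : V →ₗ[ℂ] A :=
  TensorProduct.lid ℂ A ∘ₗ l.rTensor A ∘ₗ κ.map

theorem apply_coeff (κ : Corep A V) (l : Module.Dual ℂ V) (φ : Module.Dual ℂ A) (v : V) :
    φ (κ.coeff l v) = l (κ.act φ v) := by
  simp only [coeff, act, LinearMap.comp_apply]
  induction κ.map v with
  | zero => simp
  | add x y hx hy => simp_all
  | tmul v a => simp [mul_comm]

/-- Frobenius reciprocity: intertwiners from `V` to the regular representation correspond to linear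
functionals on `V`, by `f ↦ ε ∘ f`. -/
def homRegularEquiv (κ : Corep A V) :
    (κ.Mod →ₗ[WithConv (A →ₗ[ℂ] ℂ)] (regular A).Mod) ≃ₗ[ℂ] Module.Dual ℂ V where
  toFun f := (CoalgebraStruct.counit (R := ℂ) (A := A)) ∘ₗ (f.restrictScalars ℂ : V →ₗ[ℂ] A)
  invFun l :=
    { κ.coeff l with
      map_smul' φ v := by
        refine Module.eval_apply_injective ℂ (LinearMap.ext fun ψ ↦ ?_)
        calc ψ (κ.coeff l (κ.act φ.ofConv v))
            = l (κ.act ψ (κ.act φ.ofConv v)) := κ.apply_coeff _ _ _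
          _ = l (κ.act (.toConv ψ * φ : WithConv (A →ₗ[ℂ] ℂ)).ofConv v) :=
            congrArg l (κ.act_mul (.toConv ψ) φ v).symm
          _ = (.toConv ψ * φ : WithConv (A →ₗ[ℂ] ℂ)).ofConv (κ.coeff l v) :=
            (κ.apply_coeff _ _ _).symm
          _ = ψ ((regular A).act φ.ofConv (κ.coeff l v)) :=
            (apply_sliceRight φ (.toConv ψ) _).symm }
  map_add' f g := LinearMap.ext fun v ↦
    LinearMap.map_add (CoalgebraStruct.counit (R := ℂ) (A := A)) (f v) (g v)
  map_smul' c f := LinearMap.ext fun v ↦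
    LinearMap.map_smul (CoalgebraStruct.counit (R := ℂ) (A := A)) c (f v)
  left_inv f := by
    refine LinearMap.ext fun v ↦ Module.eval_apply_injective ℂ (LinearMap.ext fun ψ ↦ ?_)
    refine (κ.apply_coeff _ ψ v).trans ?_
    have h := counit_sliceRight (A := A) ψ (f v)
    exact (congrArg (CoalgebraStruct.counit (R := ℂ) (A := A)) (f.map_smul (.toConv ψ) v)).trans h
  right_inv l := by
    ext v
    exact (κ.apply_coeff l _ v).trans (congrArg l (LinearMap.congr_fun κ.act_counit v))

theorem isSemisimpleModule_regular [IsFiniteQuantumGroup A] :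
    IsSemisimpleModule (WithConv (A →ₗ[ℂ] ℂ)) (regular A).Mod where
  exists_isCompl N := by
    let U : Submodule ℂ A := N.restrictScalars ℂ
    have hU : (regular A).IsInvariant U := isInvariant_iff.mpr fun φ u hu ↦
      N.smul_mem (.toConv φ) hu
    obtain ⟨W, hW, hmem⟩ := (innerCore A).exists_isCompl_orthogonal U
    let N' : Submodule (WithConv (A →ₗ[ℂ] ℂ)) (regular A).Mod :=
      { W.toAddSubmonoid with
        smul_mem' φ x hx := (hmem _).mpr fun u hu ↦
          act_regular_mem_orthogonal hU ((hmem x).mp hx) φ.ofConv hu }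
    refine ⟨N', ?_, ?_⟩
    · rw [Submodule.disjoint_def]
      exact fun x hx hx' ↦ (Submodule.disjoint_def (R := ℂ) (M := A)).mp hW.disjoint x hx hx'
    · rw [codisjoint_iff, Submodule.eq_top_iff']
      intro x
      have hx : (show A from x) ∈ U ⊔ W := hW.sup_eq_top ▸ Submodule.mem_top
      obtain ⟨u, hu, w, hw, huw⟩ := (Submodule.mem_sup (R := ℂ) (M := A)).mp hx
      exact Submodule.mem_sup.mpr ⟨u, hu, w, hw, huw⟩

end Corep
end QuantumGroup

/-! ### Traces on conjugate spaces and the Fourier transform -/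

namespace QuantumGroup
open TensorProduct CoalgebraStruct

section ConjTrace
variable {V : Type*} [AddCommGroup V] [Module ℂ V]

/-- The conjugate `(ē_i)` of a basis `(e_i)` of `V`. -/
def conjBasis {n : Type*} [Finite n] (b : Module.Basis n ℂ V) : Module.Basis n ℂ (Conj V) :=
  .ofEquivFun
    { toFun x i := starRingEnd ℂ (b.repr ((toConj V).symm x) i)
      invFun f := toConj V (b.equivFun.symm fun i ↦ starRingEnd ℂ (f i))
      map_add' x y := by ext; simp
      map_smul' c x := by ext; simp [map_smulₛₗ (toConj V).symm]
      left_inv x := by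
        have : (b.equivFun.symm fun i ↦ b.repr ((toConj V).symm x) i) = (toConj V).symm x :=
          b.equivFun.symm_apply_apply _
        simp only [Complex.conj_conj, this, LinearEquiv.apply_symm_apply]
      right_inv f := by
        ext i
        change starRingEnd ℂ (b.equivFun (b.equivFun.symm fun i ↦ starRingEnd ℂ (f i)) i) = f i
        simp }

theorem conjBasis_apply {n : Type*} [Finite n] (b : Module.Basis n ℂ V) (i : n) :
    conjBasis b i = toConj V (b i) := by
  classical
  apply (conjBasis b).repr.injective
  ext j
  rw [Module.Basis.repr_self]
  change _ = starRingEnd ℂ (b.repr (b i) j)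
  rw [b.repr_self]
  simp only [Finsupp.single_apply]
  split_ifs <;> simp

theorem trace_conj_eq [FiniteDimensional ℂ V] (T : V →ₗ[ℂ] V) (T' : Conj V →ₗ[ℂ] Conj V)
    (h : ∀ v, T' (toConj V v) = toConj V (T v)) :
    LinearMap.trace ℂ (Conj V) T' = starRingEnd ℂ (LinearMap.trace ℂ V T) := by
  let b := Module.finBasis ℂ V
  rw [LinearMap.trace_eq_matrix_trace ℂ b, LinearMap.trace_eq_matrix_trace ℂ (conjBasis b),
    Matrix.trace, Matrix.trace, map_sum]
  refine Finset.sum_congr rfl fun i _ ↦ ?_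
  simp only [Matrix.diag_apply, LinearMap.toMatrix_apply, conjBasis_apply, h]
  rfl

end ConjTrace

namespace Corep
variable {A V W : Type*} [NormedRing A] [StarRing A] [HopfAlgebra ℂ A] [IsFiniteQuantumGroup A]
  [AddCommGroup V] [Module ℂ V] [AddCommGroup W] [Module ℂ W]

/-- The Fourier transform of `a` at `κ` is conjugate to the action of `h(a* ·)` on `V`. -/
theorem fourier_toConj (κ : Corep A V) (a : A) (v : V) :
    κ.fourier a (toConj V v) =
      toConj V (κ.act (traceState A ∘ₗ LinearMap.mulLeft ℂ (star a)) v) := by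
  change TensorProduct.rid ℂ (Conj V) ((dualMap A a).lTensor (Conj V)
    (TensorProduct.map (toConj V).toLinearMap (starLinearEquiv ℂ (A := A)).toLinearMap
      (κ.map v))) = _
  simp only [act, LinearMap.comp_apply]
  induction κ.map v with
  | zero => simp
  | add x y hx hy => simp_all
  | tmul v x =>
    have : traceState A (star x * a) = starRingEnd ℂ (traceState A (star a * x)) := by
      rw [← traceState_star, star_mul, star_star]
    simp [dualMap_apply, this, map_smulₛₗ (toConj V)]

theorem trace_fourier [FiniteDimensional ℂ V] (κ : Corep A V) (a : A) :
    LinearMap.trace ℂ (Conj V) (κ.fourier a) = starRingEnd ℂ (LinearMap.trace ℂ V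
      (κ.act (traceState A ∘ₗ LinearMap.mulLeft ℂ (star a)))) :=
  trace_conj_eq _ _ (κ.fourier_toConj a)

end Corep

/-- The regular representation contains the irreducible representation `V_α` with multiplicity
`d_α`, so that there are finitely many of these, and traces on the regular representation are sums
of traces on the `V_α` with weights `d_α`. -/
theorem finite_and_trace_regular {A : Type*} [NormedRing A] [StarRing A] [HopfAlgebra ℂ A]
    [IsFiniteQuantumGroup A] {ι : Type*} {V : ι → Type*} [∀ α, AddCommGroup (V α)]
    [∀ α, Module ℂ (V α)] (κ : ∀ α, Corep A (V α)) (hκ : IsIrr κ) :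
    Finite ι ∧ ∀ φ : Module.Dual ℂ A, LinearMap.trace ℂ A ((Corep.regular A).act φ) =
      ∑ᶠ α, (Module.finrank ℂ (V α) : ℂ) * LinearMap.trace ℂ (V α) ((κ α).act φ) := by
  classical
  let H := WithConv (A →ₗ[ℂ] ℂ)
  let M := (Corep.regular A).Mod
  have hA : FiniteDimensional ℂ A := inferInstance
  have : FiniteDimensional ℂ M := inferInstance
  have hfin (α : ι) : FiniteDimensional ℂ (V α) := (hκ.irreducible α).finiteDimensional
  have hsimp (α : ι) : IsSimpleModule H (κ α).Mod := Corep.isIrreducible_iff.mp (hκ.irreducible α)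
  have : IsSemisimpleModule H M := Corep.isSemisimpleModule_regular
  obtain ⟨s, hind, hsup, hs⟩ := IsSemisimpleModule.exists_sSupIndep_sSup_simples_eq_top H M
  have : IsNoetherian H M := isNoetherian_of_tower ℂ inferInstance
  have : Finite s := WellFoundedGT.finite_of_sSupIndep hind
  have : Fintype s := Fintype.ofFinite s
  let S (j : s) : Submodule H M := j.1
  have hS : DirectSum.IsInternal S :=
    (DirectSum.isInternal_submodule_iff_iSupIndep_and_iSup_eq_top S).mpr
      ⟨sSupIndep_iff s |>.mp hind, by rw [← hsup, sSup_eq_iSup']⟩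
  have hsimpS (j : s) : IsSimpleModule H (S j) := hs j j.2
  -- each simple summand of the regular representation is isomorphic to some `V_α`
  have hex (j : s) : ∃ α, Nonempty ((κ α).Mod ≃ₗ[H] S j) := by
    obtain ⟨n, σ, ⟨e⟩⟩ := (Corep.regular A).exists_mod_equiv (S j)
    obtain ⟨α, hα⟩ := hκ.complete _ σ (Corep.isIrreducible_iff.mpr
      (IsSimpleModule.congr (R := H) (N := S j) e))
    exact ⟨α, ⟨(Corep.equivalent_iff.mp hα).some.trans e⟩⟩
  choose α₀ hα₀ using hex
  have hiff (α : ι) (j : s) : Nonempty ((κ α).Mod ≃ₗ[H] S j) ↔ α = α₀ j := by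
    refine ⟨fun ⟨e⟩ ↦ hκ.inequivalent _ _ (Corep.equivalent_iff.mpr
      ⟨e.trans (hα₀ j).some.symm⟩), ?_⟩
    rintro rfl
    exact hα₀ j
  -- the multiplicity of `V_α` is `dim Hom(V_α, A) = dim V_α*`
  have hcount (α : ι) : Module.finrank ℂ (V α) = ∑ j, if α = α₀ j then 1 else 0 := by
    rw [← Subspace.dual_finrank_eq, ← (κ α).homRegularEquiv.finrank_eq,
      finrank_hom_isInternal hS hsimpS]
    exact Finset.sum_congr rfl fun j _ ↦ if_congr (hiff α j) rfl rfl
  have hsurj : Function.Surjective α₀ := by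
    intro α
    by_contra! hne
    have h0 := hcount α
    rw [Finset.sum_eq_zero fun j _ ↦ if_neg (hne j).symm] at h0
    have := (hκ.irreducible α).1
    exact Module.finrank_pos.ne' h0
  have hι : Finite ι := .of_surjective α₀ hsurj
  have := Fintype.ofFinite ι
  refine ⟨hι, fun φ ↦ ?_⟩
  have htr : LinearMap.trace ℂ A ((Corep.regular A).act φ) =
      ∑ j, LinearMap.trace ℂ (V (α₀ j)) ((κ (α₀ j)).act φ) :=
    (trace_lsmul_eq_sum (k := ℂ) hS (WithConv.toConv φ)).trans <| Finset.sum_congr rfl fun j _ ↦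
      trace_lsmul_eq_of_equiv (k := ℂ) (R := H) (N := (κ (α₀ j)).Mod) (M := S j) (hα₀ j).some
        (WithConv.toConv φ)
  rw [htr, finsum_eq_sum_of_fintype]
  simp_rw [hcount]
  push_cast
  simp_rw [Finset.sum_mul]
  rw [Finset.sum_comm]
  simp

end QuantumGroup

end

theorem mainTheorem5 {A : Type*} [NormedRing A] [StarRing A] [HopfAlgebra ℂ A]
    [QuantumGroup.IsFiniteQuantumGroup A]
    {ι : Type*} {V : ι → Type*} [∀ α, AddCommGroup (V α)] [∀ α, Module ℂ (V α)]
    (κ : ∀ α, QuantumGroup.Corep A (V α)) (hκ : QuantumGroup.IsIrr κ) :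
    (∀ h : Module.Dual ℂ A, QuantumGroup.IsHaarState h ↔ h = QuantumGroup.haar A) ∧
    Function.Bijective (QuantumGroup.dualMap A) ∧
    Finite ι ∧ (∀ α, FiniteDimensional ℂ (V α)) ∧
    ∀ a : A,
      QuantumGroup.dualHaar A (QuantumGroup.dualMap A a) = CoalgebraStruct.counit (R := ℂ) a ∧
      CoalgebraStruct.counit (R := ℂ) a =
        ∑ᶠ α, (Module.finrank ℂ (V α) : ℂ) *
          LinearMap.trace ℂ (QuantumGroup.Conj (V α)) ((κ α).fourier a) := by
  obtain ⟨hι, htr⟩ := QuantumGroup.finite_and_trace_regular κ hκ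
  have hfin (α : ι) : FiniteDimensional ℂ (V α) := (hκ.irreducible α).finiteDimensional
  refine ⟨fun h ↦ ?_, QuantumGroup.dualMap_bijective, hι, hfin, fun a ↦ ⟨?_, ?_⟩⟩
  · rw [QuantumGroup.haar_eq_traceState]
    exact ⟨fun hh ↦ hh.eq QuantumGroup.isHaarState_traceState,
      fun hh ↦ hh ▸ QuantumGroup.isHaarState_traceState⟩
  · exact congrArg (CoalgebraStruct.counit (R := ℂ))
      (Function.leftInverse_invFun QuantumGroup.dualMap_bijective.injective a)
  · have := Fintype.ofFinite ι
    have h := htr (QuantumGroup.traceState A ∘ₗ LinearMap.mulLeft ℂ (star a))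
    rw [QuantumGroup.trace_act_regular, QuantumGroup.counit_star] at h
    simp only [QuantumGroup.Corep.trace_fourier]
    rw [finsum_eq_sum_of_fintype] at h ⊢
    rw [← Complex.conj_conj (CoalgebraStruct.counit (R := ℂ) a), h]
    simp
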